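/- Let $(\Omega,\mathcal A,\mathbb P,\mathbb D,\Gamma)$ be an error structure, that is: $(\Omega,\mathcal A,\mathbb P)$ is a probability space; $\mathbb D$ is a dense linear subspace of $L^2(\mathbb P)$; $\Gamma$ is a symmetric bilinear map from $\mathbb D\times\mathbb D$ to $L^1(\mathbb P)$ with $\Gamma[u]:=\Gamma[u,u]\ge 0$; for $u\in\mathbb D^m$, $v\in\mathbb D^n$ and Lipschitz functions $F:\mathbb R^m\to\mathbb R$, $G:\mathbb R^n\to\mathbb R$ of class $C^1$ one has $F(u),G(v)\in\mathbb D$ and $\Gamma[F(u),G(v)]=\sum_{i,j}\partial_iF(u)\,\partial_jG(v)\,\Gamma[u_i,v_j]$ a.s.; and the form $\mathcal E[u,v]=\frac12\int\Gamma[u,v]\,d\mathbb P$ is closed, i.e. $\mathbb D$ is complete for the norm $(\|u\|_{L^2}^2+\mathcal E[u,u])^{1/2}$. Let $(A,\mathcal DA)$ be its generator: $u\in\mathbb D$ belongs to $\mathcal DA$ if and only if there is $A[u]\in L^2(\mathbb P)$ with $\mathcal E[u,v]=-\langle A[u],v\rangle_{L^2}$ for all $v\in\mathbb D$. Put $\mathrm{sign}(y)=y/|y|$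 for $y\ne0$ and $\mathrm{sign}(0)=0$. Let $X\in\mathcal DA$ be such that $\Gamma[X]\in\mathbb D$ and $\Gamma[X]>0$ a.s. a) For every $\varepsilon>0$ one has $\frac1{\varepsilon+\Gamma[X]}\in\mathbb D$, and for every $x\in\mathbb R$ the random variable $\mathrm{sign}(x-X)\bigl(\Gamma[X,\frac1{\varepsilon+\Gamma[X]}]+\frac{2A[X]}{\varepsilon+\Gamma[X]}\bigr)$ is integrable. The law of $X$ has a density with respect to Lebesgue measure, and this density has a lower semicontinuous version $\tilde f:\mathbb R\to[0,\infty]$ such that for every $x\in\mathbb R$ $$\tilde f(x)=\lim_{\varepsilon\downarrow0}\uparrow\ \frac12\,\mathbb E\Bigl(\mathrm{sign}(x-X)\Bigl(\Gamma\bigl[X,\tfrac1{\varepsilon+\Gamma[X]}\bigr]+\frac{2A[X]}{\varepsilon+\Gamma[X]}\Bigr)\Bigr),$$ the expectation on the right being nondecreasing as $\varepsilon$ decreases to $0$. b) If in addition $\frac1{\Gamma[X]}\in\mathbb D$, then the law of $X$ has a nonnegative density $f$ which is absolutely continuous on $\mathbb R$, and for every $x\in\mathbb R$ the random variable under the following expectation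 is integrable and $$f(x)=\frac12\,\mathbb E\Bigl(\mathrm{sign}(x-X)\Bigl(\Gamma\bigl[X,\tfrac1{\Gamma[X]}\bigr]+\frac{2A[X]}{\Gamma[X]}\Bigr)\Bigr).$$ -/

import Mathlib

open MeasureTheory Filter Topology Set
open scoped ENNReal

/-- An error structure on the probability space `(Ω, P)`: a dense subspace `D` of `L²(P)` with a
square field operator `Gamma`, i.e. a symmetric, positive, bilinear map from `D × D` to `L¹(P)`
obeying the first order functional calculus for `C¹` Lipschitz functions, and such that the
quadratic form `E[u] = ½ ∫ Gamma[u, u] dP` is closed (`D` is complete for the norm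
`(‖u‖² + E[u])^{1/2}`). -/
structure ErrorStructure {Ω : Type*} [MeasurableSpace Ω] (P : Measure Ω)
    [IsProbabilityMeasure P] where
  /-- the domain `𝔻` -/
  D : Submodule ℝ (Lp ℝ 2 P)
  dense_D : Dense (D : Set (Lp ℝ 2 P))
  /-- the square field operator `Γ` -/
  Gamma : D →ₗ[ℝ] D →ₗ[ℝ] Lp ℝ 1 P
  gamma_symm : ∀ u v : D, Gamma u v = Gamma v u
  gamma_nonneg : ∀ u : D, ∀ᵐ ω ∂P, 0 ≤ Gamma u u ω
  /-- `D` is stable under `C¹` Lipschitz functions -/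
  comp_mem : ∀ (m : ℕ) (u : Fin m → D) (F : (Fin m → ℝ) → ℝ),
    ContDiff ℝ 1 F → (∃ K, LipschitzWith K F) →
    ∀ w : Lp ℝ 2 P, (∀ᵐ ω ∂P, w ω = F (fun i => (u i : Lp ℝ 2 P) ω)) → w ∈ D
  /-- `Γ[F(u), G(v)] = ∑ i j, ∂ᵢF(u) ∂ⱼG(v) Γ[uᵢ, vⱼ]` -/
  gamma_comp : ∀ (m n : ℕ) (u : Fin m → D) (v : Fin n → D)
    (F : (Fin m → ℝ) → ℝ) (G : (Fin n → ℝ) → ℝ),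
    ContDiff ℝ 1 F → (∃ K, LipschitzWith K F) →
    ContDiff ℝ 1 G → (∃ K, LipschitzWith K G) →
    ∀ p q : D,
    (∀ᵐ ω ∂P, (p : Lp ℝ 2 P) ω = F (fun i => (u i : Lp ℝ 2 P) ω)) →
    (∀ᵐ ω ∂P, (q : Lp ℝ 2 P) ω = G (fun j => (v j : Lp ℝ 2 P) ω)) →
    ∀ᵐ ω ∂P, Gamma p q ω = ∑ i : Fin m, ∑ j : Fin n,
      fderiv ℝ F (fun k => (u k : Lp ℝ 2 P) ω) (Pi.single i 1) *
      fderiv ℝ G (fun k => (v k : Lp ℝ 2 P) ω) (Pi.single j 1) * Gamma (u i) (v j) ω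
  /-- every sequence that is Cauchy for the norm `(‖u‖² + E[u])^{1/2}` converges in `D` for it -/
  closed_form : ∀ u : ℕ → D,
    (∀ ε > 0, ∃ N, ∀ m ≥ N, ∀ n ≥ N,
      ‖u m - u n‖ ^ 2 + (1 / 2) * ∫ ω, Gamma (u m - u n) (u m - u n) ω ∂P < ε) →
    ∃ v : D, Tendsto
      (fun n => ‖u n - v‖ ^ 2 + (1 / 2) * ∫ ω, Gamma (u n - v) (u n - v) ω ∂P) atTop (𝓝 0)

namespace ErrorStructure

variable {Ω : Type*} [MeasurableSpace Ω] {P : Measure Ω} [IsProbabilityMeasure P]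

/-- The Dirichlet form `E[u, v] = ½ ∫ Γ[u, v] dP`. -/
noncomputable def energy (S : ErrorStructure P) (u v : S.D) : ℝ :=
  (1 / 2) * ∫ ω, S.Gamma u v ω ∂P

/-- The domain `𝒟A` of the generator: those `u ∈ 𝔻` for which `E[u, ·]` is represented by an
element of `L²(P)`. -/
def generatorDomain (S : ErrorStructure P) : Set S.D :=
  {u | ∃ a : Lp ℝ 2 P, ∀ v : S.D, S.energy u v = - inner ℝ a (v : Lp ℝ 2 P)}

/-- The generator: `A[u]` is the element of `L²(P)` with `E[u, v] = -⟨A[u], v⟩` for all `v ∈ 𝔻`. -/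
noncomputable def generator (S : ErrorStructure P) (u : S.D) (hu : u ∈ S.generatorDomain) :
    Lp ℝ 2 P :=
  hu.choose

theorem energy_eq_neg_inner_generator (S : ErrorStructure P) (u : S.D)
    (hu : u ∈ S.generatorDomain) (v : S.D) :
    S.energy u v = - inner ℝ (S.generator u hu) (v : Lp ℝ 2 P) :=
  hu.choose_spec v

/-- `A[u]` is uniquely determined, since `𝔻` is dense. -/
theorem generator_unique (S : ErrorStructure P) (u : S.D) (hu : u ∈ S.generatorDomain)
    (a : Lp ℝ 2 P) (ha : ∀ v : S.D, S.energy u v = - inner ℝ a (v : Lp ℝ 2 P)) :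
    S.generator u hu = a := by
  refine S.dense_D.eq_of_inner_left (𝕜 := ℝ) fun v hv => ?_
  have h1 := S.energy_eq_neg_inner_generator u hu ⟨v, hv⟩
  have h2 := ha ⟨v, hv⟩
  simp only at h1 h2
  linarith

/-- A random variable (a function defined up to almost sure equality) belongs to `𝔻`. -/
def Mem (S : ErrorStructure P) (f : Ω → ℝ) : Prop :=
  ∃ u : S.D, ∀ᵐ ω ∂P, (u : Lp ℝ 2 P) ω = f ω

open Classical in
/-- `Γ[X, f]` for a random variable `f` in `𝔻` (and `0` by convention if `f` is not in `𝔻`). -/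
noncomputable def gammaWith (S : ErrorStructure P) (X : S.D) (f : Ω → ℝ) : Ω → ℝ :=
  if h : S.Mem f then fun ω => S.Gamma X h.choose ω else fun _ => 0

theorem gammaWith_eq (S : ErrorStructure P) (X : S.D) (f : Ω → ℝ) (u : S.D)
    (hu : ∀ᵐ ω ∂P, (u : Lp ℝ 2 P) ω = f ω) :
    S.gammaWith X f = fun ω => S.Gamma X u ω := by
  have h : S.Mem f := ⟨u, hu⟩
  have e : h.choose = u := by
    apply Subtype.ext
    apply Lp.ext
    filter_upwards [h.choose_spec, hu] with ω h1 h2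
    rw [h1, h2]
  unfold gammaWith
  rw [dif_pos h, e]

/-- The random variable `sign(x - X) (Γ[X, 1/R] + 2 A[X] / R)`. -/
noncomputable def densityIntegrand (S : ErrorStructure P) (X : S.D)
    (hX : X ∈ S.generatorDomain) (R : Ω → ℝ) (x : ℝ) : Ω → ℝ := fun ω =>
  Real.sign (x - (X : Lp ℝ 2 P) ω) *
    (S.gammaWith X (fun ω' => 1 / R ω') ω + 2 * S.generator X hX ω / R ω)

end ErrorStructure

/-- Absolute continuity of a function on the whole real line. -/
def AbsolutelyContinuousOnReal (f : ℝ → ℝ) : Prop :=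
  ∀ ε > 0, ∃ δ > 0, ∀ (n : ℕ) (a b : Fin n → ℝ), (∀ i, a i ≤ b i) →
    Pairwise (fun i j => Disjoint (Ioo (a i) (b i)) (Ioo (a j) (b j))) →
    ∑ i, (b i - a i) < δ → ∑ i, |f (b i) - f (a i)| < ε

/-!
The argument is an integration by parts against functions of `X`. Let `ψ` be a continuous compactly
supported function with primitive `φ = ½ ∫ ψ(x) sign(· - x) dx`, and let `h = 1 / R` be a bounded
element of `𝔻`. Testing the definition of `A[X]` against `φ(X) h` and expanding `Γ[X, φ(X) h]` by
the functional calculus gives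
`E[ψ(X) h Γ[X]] = - E[φ(X) (Γ[X, h] + 2 h A[X])]` (`ErrorStructure.integral_deriv_mul_gamma`), and
by Fubini the right-hand side is `∫ ψ(x) ½ E[sign(x - X) (Γ[X, h] + 2 h A[X])] dx`
(`integral_mul_signDensity`). So the law of `X`, weighted by `h Γ[X]`, has the bounded density
`½ E[sign(x - X) (Γ[X, h] + 2 h A[X])]`.

Take `R = ε + Γ[X]`; the weight is then `Γ[X] / (ε + Γ[X]) ∈ (0, 1]`, which increases to `1` as
`ε` decreases to `0`. Since the weight is positive and the density bounded, `X` has no atoms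
(`IsWeightedDensity.ae_ne`), and therefore `x ↦ E[sign(x - X) Z]` is continuous for every integrable
`Z`. Continuity turns the almost everywhere nonnegativity and monotonicity in `ε` of the densities
into statements valid at every point, and their increasing limit is a lower semicontinuous density
of the law of `X` (`ErrorStructure.map_eq_withDensity_lscDensity`).

If moreover `h = 1 / Γ[X] ∈ 𝔻`, then `1 / (ε + Γ[X]) = h / (1 + ε h)` is a `C¹` function of `h`,
and dominated convergence identifies that limit with `½ E[sign(x - X) (Γ[X, h] + 2 h A[X])]`
(`ErrorStructure.tendsto_regDensity`). The increments of this function over an interval are bounded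
by the mass that the image under `X` of the measure `|Γ[X, h] + 2 h A[X]| P` gives to the interval.
That image is finite and, as the law of `X` has a density, absolutely continuous with respect to
Lebesgue measure, so the function is absolutely continuous.
-/

/-! ### The sign function and primitives of test functions -/

theorem Real.measurable_sign : Measurable Real.sign :=
  Measurable.ite measurableSet_Iio measurable_const
    (Measurable.ite measurableSet_Ioi measurable_const measurable_const)

theorem Real.abs_sign_le_one (r : ℝ) : |Real.sign r| ≤ 1 := by
  rcases Real.sign_apply_eq r with h | h | h <;> simp [h]

theorem Real.continuousAt_sign {r : ℝ} (hr : r ≠ 0) : ContinuousAt Real.sign r := by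
  rcases lt_or_gt_of_ne hr with h | h
  · exact (continuousAt_const (y := (-1 : ℝ))).congr
      (by filter_upwards [Iio_mem_nhds h] with y hy using (Real.sign_of_neg hy).symm)
  · exact (continuousAt_const (y := (1 : ℝ))).congr
      (by filter_upwards [Ioi_mem_nhds h] with y hy using (Real.sign_of_pos hy).symm)

/-- The primitive `y ↦ ½ ∫ ψ(x) sign(y - x) dx` of `ψ`, normalised to have opposite limits at
`-∞` and `+∞`. -/
noncomputable def signPrimitive (ψ : ℝ → ℝ) (y : ℝ) : ℝ :=
  (1 / 2) * ∫ x, ψ x * Real.sign (y - x)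

theorem integrable_mul_sign {ψ : ℝ → ℝ} (hψ : Integrable ψ) (y : ℝ) :
    Integrable (fun x => ψ x * Real.sign (y - x)) :=
  hψ.mul_bdd (c := 1)
    (Real.measurable_sign.comp (measurable_const.sub measurable_id)).aestronglyMeasurable
    (ae_of_all _ fun _ => Real.abs_sign_le_one _)

theorem signPrimitive_eq {ψ : ℝ → ℝ} (hψ : Integrable ψ) (y : ℝ) :
    signPrimitive ψ y = (∫ x in (0 : ℝ)..y, ψ x) + signPrimitive ψ 0 := by
  have key : ∀ y, signPrimitive ψ y = (∫ x in Iic y, ψ x) - (1 / 2) * ∫ x, ψ x := by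
    intro y
    have h1 : ∫ x, ψ x * Real.sign (y - x) = (∫ x in Iic y, ψ x) - ∫ x in Ioi y, ψ x := by
      rw [← intervalIntegral.integral_Iic_add_Ioi (b := y)
        (integrable_mul_sign hψ y).integrableOn (integrable_mul_sign hψ y).integrableOn,
        sub_eq_add_neg, ← integral_neg]
      congr 1
      · refine setIntegral_congr_ae measurableSet_Iic ?_
        filter_upwards [compl_mem_ae_iff.mpr (measure_singleton (μ := volume) y)] with x hx hxy
        rw [Real.sign_of_pos (sub_pos.mpr (lt_of_le_of_ne hxy hx)), mul_one]
      · refine setIntegral_congr_fun measurableSet_Ioi fun x hx => ?_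
        rw [Real.sign_of_neg (sub_neg.mpr hx), mul_neg_one]
    have h2 := intervalIntegral.integral_Iic_add_Ioi (b := y) hψ.integrableOn hψ.integrableOn
    rw [signPrimitive, h1, ← h2]
    ring
  rw [key y, key 0, ← intervalIntegral.integral_Iic_sub_Iic hψ.integrableOn hψ.integrableOn]
  ring

theorem hasDerivAt_signPrimitive {ψ : ℝ → ℝ} (hc : Continuous ψ) (hψ : Integrable ψ) (y : ℝ) :
    HasDerivAt (signPrimitive ψ) (ψ y) y := by
  rw [funext (signPrimitive_eq hψ)]
  exact (hc.integral_hasStrictDerivAt 0 y).hasDerivAt.add_const _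

theorem abs_signPrimitive_le {ψ : ℝ → ℝ} (hψ : Integrable ψ) (y : ℝ) :
    |signPrimitive ψ y| ≤ (1 / 2) * ∫ x, |ψ x| := by
  rw [signPrimitive, abs_mul, abs_of_pos (by norm_num : (0 : ℝ) < 1 / 2)]
  gcongr
  refine (abs_integral_le_integral_abs).trans
    (integral_mono (integrable_mul_sign hψ y).abs hψ.abs fun x => ?_)
  simp only [abs_mul]
  exact mul_le_of_le_one_right (abs_nonneg _) (Real.abs_sign_le_one _)

/-- The tent function of height `1` and half-width `r` centred at `x₀`. -/
noncomputable def tent (x₀ r x : ℝ) : ℝ := max 0 (1 - |x - x₀| / r)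

theorem continuous_tent (x₀ r : ℝ) : Continuous (tent x₀ r) := by
  unfold tent; fun_prop

theorem tent_nonneg (x₀ r x : ℝ) : 0 ≤ tent x₀ r x := le_max_left _ _

theorem tent_le_one {r : ℝ} (hr : 0 < r) (x₀ x : ℝ) : tent x₀ r x ≤ 1 := by
  have : 0 ≤ |x - x₀| / r := by positivity
  exact max_le zero_le_one (by linarith)

theorem tent_self (x₀ r : ℝ) : tent x₀ r x₀ = 1 := by simp [tent]

theorem tent_eq_zero {x₀ r x : ℝ} (hr : 0 < r) (hx : x ∉ Icc (x₀ - r) (x₀ + r)) :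
    tent x₀ r x = 0 := by
  refine max_eq_left (sub_nonpos.mpr ((one_le_div hr).mpr ?_))
  by_contra! h
  rw [abs_lt] at h
  exact hx ⟨by linarith, by linarith⟩

theorem hasCompactSupport_tent {r : ℝ} (hr : 0 < r) (x₀ : ℝ) : HasCompactSupport (tent x₀ r) :=
  HasCompactSupport.intro isCompact_Icc fun _ hx => tent_eq_zero hr hx

theorem integral_tent_le {r : ℝ} (hr : 0 < r) (x₀ : ℝ) : ∫ x, tent x₀ r x ≤ 2 * r := by
  have h : ∫ x, tent x₀ r x = ∫ x in Icc (x₀ - r) (x₀ + r), tent x₀ r x :=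
    (setIntegral_eq_integral_of_forall_compl_eq_zero fun x hx => tent_eq_zero hr hx).symm
  rw [h]
  refine (setIntegral_mono ((continuous_tent _ _).continuousOn.integrableOn_compact isCompact_Icc)
    (integrableOn_const (C := (1 : ℝ)) (by simp)) (tent_le_one hr x₀)).trans ?_
  simp only [setIntegral_const, smul_eq_mul, mul_one, measureReal_def, Real.volume_Icc]
  rw [ENNReal.toReal_ofReal (by linarith)]
  linarith

/-- A continuous function is nonnegative as soon as its integrals against nonnegative test
functions are. -/
theorem Continuous.nonneg_of_integral_mul_nonneg {g : ℝ → ℝ} (hg : Continuous g)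
    (h : ∀ ψ : ℝ → ℝ, Continuous ψ → HasCompactSupport ψ → (∀ x, 0 ≤ ψ x) →
      0 ≤ ∫ x, ψ x * g x) (x₀ : ℝ) : 0 ≤ g x₀ := by
  by_contra! hneg
  obtain ⟨r, hr, hball⟩ := Metric.isOpen_iff.mp (isOpen_lt hg continuous_const) x₀ hneg
  have hr2 : 0 < r / 2 := by positivity
  have hpos : 0 < ∫ x, tent x₀ (r / 2) x * -g x := by
    refine Continuous.integral_pos_of_hasCompactSupport_nonneg_nonzero
      (f := fun x => tent x₀ (r / 2) x * -g x) (x := x₀) ((continuous_tent _ _).mul hg.neg)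
      ((hasCompactSupport_tent hr2 x₀).mul_right) (fun x => ?_) ?_
    · by_cases hx : x ∈ Icc (x₀ - r / 2) (x₀ + r / 2)
      · have : x ∈ Metric.ball x₀ r := by
          rw [Metric.mem_ball, Real.dist_eq, abs_lt]
          exact ⟨by linarith [hx.1], by linarith [hx.2]⟩
        have hgx : g x < 0 := hball this
        exact mul_nonneg (tent_nonneg _ _ _) (by linarith)
      · simp [tent_eq_zero hr2 hx]
    · rw [tent_self]; simpa using hneg.ne
  have := h _ (continuous_tent x₀ (r / 2)) (hasCompactSupport_tent hr2 x₀) (tent_nonneg _ _)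
  simp only [mul_neg, integral_neg] at hpos
  linarith

/-! ### A bounded function of class `C¹` that saturates at infinity -/

/-- The function `y ↦ y / (ε + |y|)`: it is bounded, Lipschitz and of class `C¹` on the whole real
line, and on `[0, ∞)` it gives `1 / (ε + y) = (1 - saturation ε y) / ε`. -/
noncomputable def saturation (ε y : ℝ) : ℝ := y / (ε + |y|)

theorem abs_saturation_le_one {ε : ℝ} (hε : 0 < ε) (y : ℝ) : |saturation ε y| ≤ 1 := by
  have : 0 < ε + |y| := by positivity
  rw [saturation, abs_div, abs_of_pos this, div_le_one this]
  linarith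

theorem hasDerivAt_saturation {ε : ℝ} (hε : 0 < ε) (y : ℝ) :
    HasDerivAt (saturation ε) (ε / (ε + |y|) ^ 2) y := by
  rcases lt_trichotomy y 0 with h | rfl | h
  · have h0 : ε + -y ≠ 0 := by linarith
    have : HasDerivAt (fun y => y / (ε + -y)) (ε / (ε + |y|) ^ 2) y := by
      refine ((hasDerivAt_id y).div ((hasDerivAt_id y).neg.const_add ε) h0).congr_deriv ?_
      rw [abs_of_neg h]; simp
    exact this.congr_of_eventuallyEq
      (by filter_upwards [Iio_mem_nhds h] with z hz; rw [saturation, abs_of_neg hz])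
  · rw [hasDerivAt_iff_tendsto_slope]
    have h1 : Tendsto (fun z : ℝ => 1 / (ε + |z|)) (𝓝[≠] 0) (𝓝 (1 / (ε + |0|))) := by
      refine (ContinuousAt.tendsto ?_).mono_left nhdsWithin_le_nhds
      have : ε + |(0 : ℝ)| ≠ 0 := by simpa using hε.ne'
      fun_prop (disch := assumption)
    have e : ε / (ε + |(0 : ℝ)|) ^ 2 = 1 / (ε + |0|) := by
      simp only [abs_zero, add_zero]; field_simp
    rw [e]
    refine h1.congr' ?_
    filter_upwards [self_mem_nhdsWithin] with z hz
    have hz : z ≠ 0 := hz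
    have : 0 < ε + |z| := by positivity
    simp only [slope, saturation, vsub_eq_sub, sub_zero, zero_div, smul_eq_mul]
    field_simp
  · have h0 : ε + y ≠ 0 := by linarith
    have : HasDerivAt (fun y => y / (ε + y)) (ε / (ε + |y|) ^ 2) y := by
      refine ((hasDerivAt_id y).div ((hasDerivAt_id y).const_add ε) h0).congr_deriv ?_
      rw [abs_of_pos h]; simp
    exact this.congr_of_eventuallyEq
      (by filter_upwards [Ioi_mem_nhds h] with z hz; rw [saturation, abs_of_pos hz])

theorem abs_deriv_saturation_le {ε : ℝ} (hε : 0 < ε) (y : ℝ) :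
    |ε / (ε + |y|) ^ 2| ≤ 1 / ε := by
  rw [abs_of_nonneg (by positivity), div_le_div_iff₀ (by positivity) hε]
  nlinarith [abs_nonneg y]

theorem continuous_deriv_saturation {ε : ℝ} (hε : 0 < ε) :
    Continuous fun y : ℝ => ε / (ε + |y|) ^ 2 := by
  have : ∀ y : ℝ, (ε + |y|) ^ 2 ≠ 0 := fun y => by positivity
  fun_prop (disch := assumption)

/-! ### Densities of the form `½ E[sign(x - X) Z]` -/

section SignDensity

variable {Ω : Type*} [MeasurableSpace Ω]

/-- The function `x ↦ ½ E[sign(x - X) Z]`. -/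
noncomputable def signDensity (P : Measure Ω) (X Z : Ω → ℝ) (x : ℝ) : ℝ :=
  (1 / 2) * ∫ ω, Real.sign (x - X ω) * Z ω ∂P

variable {P : Measure Ω} {X Z : Ω → ℝ}

theorem integrable_sign_mul (hX : Measurable X) (hZ : Integrable Z P) (x : ℝ) :
    Integrable (fun ω => Real.sign (x - X ω) * Z ω) P :=
  hZ.bdd_mul (c := 1)
    (Real.measurable_sign.comp (measurable_const.sub hX)).aestronglyMeasurable
    (ae_of_all _ fun _ => Real.abs_sign_le_one _)

theorem abs_signDensity_le (hX : Measurable X) (hZ : Integrable Z P) (x : ℝ) :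
    |signDensity P X Z x| ≤ (1 / 2) * ∫ ω, |Z ω| ∂P := by
  rw [signDensity, abs_mul, abs_of_pos (by norm_num : (0 : ℝ) < 1 / 2)]
  gcongr
  refine abs_integral_le_integral_abs.trans
    (integral_mono (integrable_sign_mul hX hZ x).abs hZ.abs fun ω => ?_)
  simp only [abs_mul]
  exact mul_le_of_le_one_left (abs_nonneg _) (Real.abs_sign_le_one _)

theorem integrable_uncurry_mul_sign [SFinite P] {ψ : ℝ → ℝ} (hψ : Integrable ψ)
    (hX : Measurable X) (hZ : Integrable Z P) :
    Integrable (fun p : ℝ × Ω => (ψ p.1 * Z p.2) * Real.sign (p.1 - X p.2))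
      (volume.prod P) :=
  (hψ.mul_prod hZ).mul_bdd (c := 1)
    (Real.measurable_sign.comp
      (measurable_fst.sub (hX.comp measurable_snd))).aestronglyMeasurable
    (ae_of_all _ fun _ => Real.abs_sign_le_one _)

theorem integrable_mul_signDensity [SFinite P] {ψ : ℝ → ℝ} (hψ : Integrable ψ)
    (hX : Measurable X) (hZ : Integrable Z P) :
    Integrable (fun x => ψ x * signDensity P X Z x) := by
  refine ((integrable_uncurry_mul_sign hψ hX hZ).integral_prod_left.const_mul (1 / 2)).congr
    (ae_of_all _ fun x => ?_)
  simp only [signDensity]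
  rw [mul_left_comm, ← integral_const_mul (ψ x)]
  congr 2 with ω
  ring

theorem integral_mul_signDensity [SFinite P] {ψ : ℝ → ℝ} (hψ : Integrable ψ)
    (hX : Measurable X) (hZ : Integrable Z P) :
    ∫ x, ψ x * signDensity P X Z x = -∫ ω, signPrimitive ψ (X ω) * Z ω ∂P := by
  have h1 : ∀ x, ψ x * signDensity P X Z x
      = (1 / 2) * ∫ ω, (ψ x * Z ω) * Real.sign (x - X ω) ∂P := fun x => by
    rw [signDensity, mul_left_comm, ← integral_const_mul (ψ x)]
    congr 2 with ω
    ring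
  have h2 : ∀ ω, signPrimitive ψ (X ω) * Z ω
      = -((1 / 2) * ∫ x, (ψ x * Z ω) * Real.sign (x - X ω)) := fun ω => by
    rw [signPrimitive, mul_assoc, ← integral_mul_const, ← mul_neg, ← integral_neg]
    congr 2 with x
    rw [← neg_sub x, Real.sign_neg]
    ring
  simp_rw [h1, h2, integral_neg, neg_neg, integral_const_mul]
  rw [integral_integral_swap (f := fun x ω => (ψ x * Z ω) * Real.sign (x - X ω))
    (integrable_uncurry_mul_sign hψ hX hZ)]

theorem continuous_signDensity (hX : Measurable X) (hZ : Integrable Z P)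
    (hatom : ∀ x, ∀ᵐ ω ∂P, X ω ≠ x) : Continuous (signDensity P X Z) := by
  refine continuous_iff_continuousAt.mpr fun x => ContinuousAt.const_mul ?_ _
  refine continuousAt_of_dominated (bound := fun ω => |Z ω|)
    (Eventually.of_forall fun y => (integrable_sign_mul hX hZ y).1)
    (Eventually.of_forall fun y => ae_of_all _ fun ω => ?_) hZ.abs ?_
  · rw [Real.norm_eq_abs, abs_mul]
    exact mul_le_of_le_one_left (abs_nonneg _) (Real.abs_sign_le_one _)
  · filter_upwards [hatom x] with ω hω
    have h : ContinuousAt (fun y => Real.sign (y - X ω)) x :=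
      ContinuousAt.comp (f := fun y => y - X ω) (g := Real.sign)
        (Real.continuousAt_sign (sub_ne_zero.mpr (Ne.symm hω))) (by fun_prop)
    exact h.mul continuousAt_const

/-- The function `signDensity P X Z` represents, against test functions, the image under `X` of
the measure of density `k` with respect to `P`. -/
def IsWeightedDensity (P : Measure Ω) (X Z k : Ω → ℝ) : Prop :=
  ∀ ψ : ℝ → ℝ, Continuous ψ → HasCompactSupport ψ →
    ∫ x, ψ x * signDensity P X Z x = ∫ ω, ψ (X ω) * k ω ∂P

theorem integrable_comp_mul {ψ : ℝ → ℝ} (hψ : Continuous ψ) (hc : HasCompactSupport ψ)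
    (hX : Measurable X) {k : Ω → ℝ} (hk : Integrable k P) :
    Integrable (fun ω => ψ (X ω) * k ω) P := by
  obtain ⟨C, hC⟩ := hψ.bounded_above_of_compact_support hc
  exact hk.bdd_mul (c := C) (hψ.measurable.comp hX).aestronglyMeasurable
    (ae_of_all _ fun ω => hC _)

/-- A random variable whose law, weighted by a positive function, has a bounded density, has no
atoms: tents of half-width `r → 0` centred at a putative atom have integral `O(r)`. -/
theorem IsWeightedDensity.ae_ne [SFinite P] {k : Ω → ℝ} (h : IsWeightedDensity P X Z k)
    (hX : Measurable X) (hZ : Integrable Z P) (hk : Integrable k P) (hpos : ∀ᵐ ω ∂P, 0 < k ω)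
    (x₀ : ℝ) : ∀ᵐ ω ∂P, X ω ≠ x₀ := by
  set C := (1 / 2) * ∫ ω, |Z ω| ∂P
  have hC : 0 ≤ C := by positivity
  have hms : MeasurableSet (X ⁻¹' {x₀}) := hX (measurableSet_singleton x₀)
  have hbound : ∀ r : ℝ, 0 < r → ∫ ω in X ⁻¹' {x₀}, k ω ∂P ≤ C * (2 * r) := by
    intro r hr
    have hψ := continuous_tent x₀ r
    have hc := hasCompactSupport_tent hr x₀
    calc ∫ ω in X ⁻¹' {x₀}, k ω ∂P
        ≤ ∫ ω, tent x₀ r (X ω) * k ω ∂P := by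
          rw [← integral_indicator hms]
          refine integral_mono_ae (hk.indicator hms) (integrable_comp_mul hψ hc hX hk) ?_
          filter_upwards [hpos] with ω hω
          by_cases hx : ω ∈ X ⁻¹' {x₀}
          · have hx' : X ω = x₀ := hx
            simp [hx', tent_self]
          · rw [indicator_of_notMem hx]
            exact mul_nonneg (tent_nonneg _ _ _) hω.le
      _ = ∫ x, tent x₀ r x * signDensity P X Z x := (h _ hψ hc).symm
      _ ≤ ∫ x, tent x₀ r x * C := by
          have hi := hψ.integrable_of_hasCompactSupport (μ := volume) hc
          refine integral_mono (integrable_mul_signDensity hi hX hZ) (hi.mul_const C) fun x => ?_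
          exact mul_le_mul_of_nonneg_left
            ((le_abs_self _).trans (abs_signDensity_le hX hZ x)) (tent_nonneg _ _ _)
      _ ≤ C * (2 * r) := by
          rw [integral_mul_const, mul_comm]
          exact mul_le_mul_of_nonneg_left (integral_tent_le hr x₀) hC
  have hle : ∫ ω in X ⁻¹' {x₀}, k ω ∂P ≤ 0 := by
    have ht : Tendsto (fun r : ℝ => C * (2 * r)) (𝓝[>] 0) (𝓝 0) := by
      have : Continuous fun r : ℝ => C * (2 * r) := by fun_prop
      simpa using (this.tendsto 0).mono_left nhdsWithin_le_nhds
    exact ge_of_tendsto ht (by filter_upwards [self_mem_nhdsWithin] with r hr using hbound r hr)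
  have hnn : 0 ≤ᵐ[P.restrict (X ⁻¹' {x₀})] k :=
    ae_restrict_of_ae (hpos.mono fun _ h => h.le)
  have hz := (setIntegral_eq_zero_iff_of_nonneg_ae hnn hk.integrableOn).mp
    (le_antisymm hle (integral_nonneg_of_ae hnn))
  rw [Filter.EventuallyEq, ae_restrict_iff' hms] at hz
  filter_upwards [hz, hpos] with ω h1 h2 h3
  exact h2.ne' (h1 h3)

theorem IsWeightedDensity.le_of_ae_le [SFinite P] {Z' k k' : Ω → ℝ}
    (h : IsWeightedDensity P X Z k) (h' : IsWeightedDensity P X Z' k')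
    (hX : Measurable X) (hZ : Integrable Z P) (hZ' : Integrable Z' P)
    (hk : Integrable k P) (hk' : Integrable k' P)
    (hatom : ∀ x, ∀ᵐ ω ∂P, X ω ≠ x) (hle : ∀ᵐ ω ∂P, k ω ≤ k' ω) (x : ℝ) :
    signDensity P X Z x ≤ signDensity P X Z' x := by
  refine sub_nonneg.mp (Continuous.nonneg_of_integral_mul_nonneg
    (g := fun x => signDensity P X Z' x - signDensity P X Z x)
    ((continuous_signDensity hX hZ' hatom).sub (continuous_signDensity hX hZ hatom)) ?_ x)
  intro ψ hψ hc hnn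
  have hi := hψ.integrable_of_hasCompactSupport (μ := volume) hc
  simp_rw [mul_sub]
  rw [integral_sub (integrable_mul_signDensity hi hX hZ') (integrable_mul_signDensity hi hX hZ),
    h ψ hψ hc, h' ψ hψ hc, sub_nonneg]
  refine integral_mono_ae (integrable_comp_mul hψ hc hX hk) (integrable_comp_mul hψ hc hX hk') ?_
  filter_upwards [hle] with ω hω
  exact mul_le_mul_of_nonneg_left hω (hnn _)

theorem IsWeightedDensity.nonneg [SFinite P] {k : Ω → ℝ} (h : IsWeightedDensity P X Z k)
    (hX : Measurable X) (hZ : Integrable Z P) (hk : ∀ᵐ ω ∂P, 0 ≤ k ω)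
    (hatom : ∀ x, ∀ᵐ ω ∂P, X ω ≠ x) (x : ℝ) : 0 ≤ signDensity P X Z x := by
  refine (continuous_signDensity hX hZ hatom).nonneg_of_integral_mul_nonneg
    (fun ψ hψ hc hnn => ?_) x
  rw [h ψ hψ hc]
  refine integral_nonneg_of_ae ?_
  filter_upwards [hk] with ω hω using mul_nonneg (hnn _) hω

theorem IsWeightedDensity.map_withDensity [IsFiniteMeasure P] {k : Ω → ℝ}
    (h : IsWeightedDensity P X Z k) (hX : Measurable X) (hZ : Integrable Z P)
    (hk : Integrable k P) (hpos : ∀ᵐ ω ∂P, 0 ≤ k ω) (hatom : ∀ x, ∀ᵐ ω ∂P, X ω ≠ x) :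
    (P.withDensity fun ω => ENNReal.ofReal (k ω)).map X =
      (volume : Measure ℝ).withDensity fun x => ENNReal.ofReal (signDensity P X Z x) := by
  have hcont := continuous_signDensity hX hZ hatom
  have : IsFiniteMeasure (P.withDensity fun ω => ENNReal.ofReal (k ω)) :=
    isFiniteMeasure_withDensity_ofReal hk.2
  have : IsLocallyFiniteMeasure
      ((volume : Measure ℝ).withDensity fun x => ENNReal.ofReal (signDensity P X Z x)) :=
    IsLocallyFiniteMeasure.withDensity_ofReal hcont
  refine Measure.ext_of_integral_eq_on_compactlySupported fun ψ => ?_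
  have e1 : ∫ x, ψ x ∂(P.withDensity fun ω => ENNReal.ofReal (k ω)).map X
      = ∫ ω, ψ (X ω) * k ω ∂P := by
    have hψ : Continuous fun x => ψ x := ψ.continuous
    rw [integral_map hX.aemeasurable hψ.aestronglyMeasurable,
      integral_withDensity_eq_integral_toReal_smul₀ hk.1.aemeasurable.ennreal_ofReal
        (ae_of_all _ fun _ => ENNReal.ofReal_lt_top)]
    refine integral_congr_ae ?_
    filter_upwards [hpos] with ω hω
    rw [ENNReal.toReal_ofReal hω, smul_eq_mul, mul_comm]
  have e2 : ∫ x, ψ x ∂(volume : Measure ℝ).withDensity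
      (fun x => ENNReal.ofReal (signDensity P X Z x)) = ∫ x, ψ x * signDensity P X Z x := by
    rw [integral_withDensity_eq_integral_toReal_smul hcont.measurable.ennreal_ofReal
        (ae_of_all _ fun _ => ENNReal.ofReal_lt_top)]
    refine integral_congr_ae (ae_of_all _ fun x => ?_)
    simp only
    rw [ENNReal.toReal_ofReal (h.nonneg hX hZ hpos hatom x), smul_eq_mul, mul_comm]
  rw [e1, e2, h ψ ψ.continuous ψ.hasCompactSupport]

/-- If the law of `X` has a density, then the image under `X` of the finite measure `|Z| P` is
absolutely continuous with respect to Lebesgue measure, and it controls the increments of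
`signDensity P X Z`. -/
theorem absolutelyContinuousOnReal_signDensity (hX : Measurable X)
    (hZ : Integrable Z P) (hatom : ∀ x, ∀ᵐ ω ∂P, X ω ≠ x) {f : ℝ → ℝ≥0∞}
    [IsFiniteMeasure P]
    (hf : P.map X = (volume : Measure ℝ).withDensity f) :
    AbsolutelyContinuousOnReal (signDensity P X Z) := by
  have hincr : ∀ a b : ℝ, a ≤ b → ENNReal.ofReal |signDensity P X Z b - signDensity P X Z a|
      ≤ ∫⁻ ω in X ⁻¹' Ioo a b, ‖Z ω‖ₑ ∂P := by
    intro a b hab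
    have e : signDensity P X Z b - signDensity P X Z a
        = ∫ ω, (1 / 2) * ((Real.sign (b - X ω) - Real.sign (a - X ω)) * Z ω) ∂P := by
      simp only [signDensity]
      rw [← mul_sub, ← integral_sub (integrable_sign_mul hX hZ b) (integrable_sign_mul hX hZ a),
        integral_const_mul]
      simp_rw [sub_mul]
    rw [← Real.enorm_eq_ofReal_abs, e, ← lintegral_indicator (hX measurableSet_Ioo)]
    refine (enorm_integral_le_lintegral_enorm _).trans (lintegral_mono_ae ?_)
    filter_upwards [hatom a, hatom b] with ω ha hb
    by_cases hω : ω ∈ X ⁻¹' Ioo a b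
    · have h1 : X ω ∈ Ioo a b := hω
      rw [indicator_of_mem hω, Real.sign_of_pos (sub_pos.mpr h1.2),
        Real.sign_of_neg (sub_neg.mpr h1.1)]
      refine le_of_eq ?_
      congr 1
      ring
    · have hs : Real.sign (b - X ω) = Real.sign (a - X ω) := by
        rcases lt_or_gt_of_ne ha with h1 | h1
        · rw [Real.sign_of_pos (by linarith), Real.sign_of_pos (by linarith)]
        · have h2 : b < X ω := by
            by_contra! h3
            exact hω ⟨h1, lt_of_le_of_ne h3 hb⟩
          rw [Real.sign_of_neg (by linarith), Real.sign_of_neg (by linarith)]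
      simp [hs]
  have hfin : ∫⁻ x, f x ≠ ∞ := by
    rw [← setLIntegral_univ, ← withDensity_apply _ MeasurableSet.univ, ← hf]
    exact measure_ne_top _ _
  intro ε hε
  obtain ⟨δ₁, hδ₁, H₁⟩ := exists_pos_setLIntegral_lt_of_measure_lt (μ := P)
    (f := fun ω => ‖Z ω‖ₑ) hZ.2.ne (ε := ENNReal.ofReal ε) (by simpa using hε)
  obtain ⟨δ₂, hδ₂, H₂⟩ := exists_pos_setLIntegral_lt_of_measure_lt hfin hδ₁.ne'
  obtain ⟨δ, hδ, hδle⟩ : ∃ δ : ℝ, 0 < δ ∧ ENNReal.ofReal δ ≤ δ₂ := by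
    rcases eq_or_ne δ₂ ∞ with h | h
    · exact ⟨1, one_pos, by simp [h]⟩
    · exact ⟨δ₂.toReal, ENNReal.toReal_pos hδ₂.ne' h, by rw [ENNReal.ofReal_toReal h]⟩
  refine ⟨δ, hδ, fun n a b hab hdisj hsum => ?_⟩
  set U : Set ℝ := ⋃ i, Ioo (a i) (b i)
  have hU : MeasurableSet U := MeasurableSet.iUnion fun i => measurableSet_Ioo
  have hvol : volume U < δ₂ := by
    refine (measure_iUnion_le _).trans_lt (lt_of_lt_of_le ?_ hδle)
    simp only [Real.volume_Ioo, tsum_fintype]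
    rw [← ENNReal.ofReal_sum_of_nonneg fun i _ => sub_nonneg.mpr (hab i)]
    exact (ENNReal.ofReal_lt_ofReal_iff hδ).mpr hsum
  have hPU : P (X ⁻¹' U) < δ₁ := by
    rw [← Measure.map_apply hX hU, hf, withDensity_apply _ hU]
    exact H₂ U hvol
  have hlt : ENNReal.ofReal (∑ i, |signDensity P X Z (b i) - signDensity P X Z (a i)|)
      < ENNReal.ofReal ε := by
    rw [ENNReal.ofReal_sum_of_nonneg fun i _ => abs_nonneg _]
    calc _ ≤ ∑ i, ∫⁻ ω in X ⁻¹' Ioo (a i) (b i), ‖Z ω‖ₑ ∂P :=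
          Finset.sum_le_sum fun i _ => hincr _ _ (hab i)
      _ = ∫⁻ ω in X ⁻¹' U, ‖Z ω‖ₑ ∂P := by
          rw [preimage_iUnion, lintegral_iUnion (fun i => hX measurableSet_Ioo)
            (fun i j hij => (hdisj hij).preimage X), tsum_fintype]
      _ < _ := H₁ _ hPU
  exact (ENNReal.ofReal_lt_ofReal_iff hε).mp hlt

end SignDensity

/-! ### Functional calculus and integration by parts in an error structure -/

namespace ErrorStructure

variable {Ω : Type*} [MeasurableSpace Ω] {P : Measure Ω} [IsProbabilityMeasure P]

theorem integrable_gamma (S : ErrorStructure P) (u v : S.D) : Integrable (S.Gamma u v) P :=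
  L1.integrable_coeFn _

theorem measurable_coe (S : ErrorStructure P) (u : S.D) : Measurable (u : Lp ℝ 2 P) :=
  (Lp.stronglyMeasurable _).measurable

theorem integrable_gammaWith (S : ErrorStructure P) (X : S.D) (f : Ω → ℝ) :
    Integrable (S.gammaWith X f) P := by
  unfold gammaWith
  split_ifs with h
  · exact S.integrable_gamma _ _
  · exact integrable_zero _ _ _

theorem mem_of_bounded (S : ErrorStructure P) {m : ℕ} (u : Fin m → S.D) {F : (Fin m → ℝ) → ℝ}
    (hF : ContDiff ℝ 1 F) (hL : ∃ K, LipschitzWith K F) {B : ℝ} (hB : ∀ p, |F p| ≤ B)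
    {f : Ω → ℝ} (hf : ∀ᵐ ω ∂P, f ω = F fun i => (u i : Lp ℝ 2 P) ω) : S.Mem f := by
  have hmeas : Measurable fun ω => F fun i => (u i : Lp ℝ 2 P) ω :=
    hF.continuous.measurable.comp (measurable_pi_lambda _ fun i => S.measurable_coe (u i))
  have hLp : MemLp (fun ω => F fun i => (u i : Lp ℝ 2 P) ω) 2 P :=
    MemLp.of_bound hmeas.aestronglyMeasurable B (ae_of_all _ fun _ => hB _)
  refine ⟨⟨hLp.toLp _, S.comp_mem m u F hF hL _ hLp.coeFn_toLp⟩, ?_⟩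
  filter_upwards [hLp.coeFn_toLp, hf] with ω h1 h2
  rw [h1, h2]

theorem gamma_comp_right (S : ErrorStructure P) (X : S.D) {n : ℕ} (v : Fin n → S.D)
    {G : (Fin n → ℝ) → ℝ} (hG : ContDiff ℝ 1 G) (hL : ∃ K, LipschitzWith K G) {q : S.D}
    (hq : ∀ᵐ ω ∂P, (q : Lp ℝ 2 P) ω = G fun j => (v j : Lp ℝ 2 P) ω) :
    ∀ᵐ ω ∂P, S.Gamma X q ω = ∑ j : Fin n,
      fderiv ℝ G (fun k => (v k : Lp ℝ 2 P) ω) (Pi.single j 1) * S.Gamma X (v j) ω := by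
  filter_upwards [S.gamma_comp 1 n (fun _ => X) v (fun p => p 0) G (contDiff_apply _ _ _)
    ⟨1, LipschitzWith.eval 0⟩ hG hL X q (ae_of_all _ fun _ => rfl) hq] with ω h
  rw [h, Fin.sum_univ_one]
  have : fderiv ℝ (fun p : Fin 1 → ℝ => p 0) (fun _ => (X : Lp ℝ 2 P) ω) (Pi.single 0 1) = 1 := by
    rw [(hasFDerivAt_apply (𝕜 := ℝ) (0 : Fin 1) (fun _ : Fin 1 => (X : Lp ℝ 2 P) ω)).fderiv]
    simp
  simp [this]

end ErrorStructure

/-- A bounded function with a continuous, bounded derivative. -/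
structure IsBoundedC1 (φ φ' : ℝ → ℝ) : Prop where
  hasDerivAt : ∀ y, HasDerivAt φ (φ' y) y
  continuous_deriv : Continuous φ'
  bounded : ∃ B, ∀ y, |φ y| ≤ B
  bounded_deriv : ∃ C, ∀ y, |φ' y| ≤ C

namespace IsBoundedC1

variable {φ φ' H H' : ℝ → ℝ}

theorem contDiff (h : IsBoundedC1 φ φ') : ContDiff ℝ 1 φ := by
  rw [contDiff_one_iff_deriv]
  refine ⟨fun y => (h.hasDerivAt y).differentiableAt, ?_⟩
  rw [funext fun y => (h.hasDerivAt y).deriv]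
  exact h.continuous_deriv

theorem const (c : ℝ) : IsBoundedC1 (fun _ => c) (fun _ => 0) where
  hasDerivAt _ := hasDerivAt_const _ _
  continuous_deriv := continuous_const
  bounded := ⟨|c|, fun _ => le_rfl⟩
  bounded_deriv := ⟨0, by simp⟩

theorem hasFDerivAt_mul (hφ : IsBoundedC1 φ φ') (hH : IsBoundedC1 H H') (p : Fin 2 → ℝ) :
    HasFDerivAt (fun p : Fin 2 → ℝ => φ (p 0) * H (p 1))
      (φ (p 0) • H' (p 1) • ContinuousLinearMap.proj (R := ℝ) (φ := fun _ : Fin 2 => ℝ) 1 +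
        H (p 1) • φ' (p 0) • ContinuousLinearMap.proj (R := ℝ) (φ := fun _ : Fin 2 => ℝ) 0) p :=
  ((hφ.hasDerivAt (p 0)).comp_hasFDerivAt p (hasFDerivAt_apply (𝕜 := ℝ) 0 p)).mul
    ((hH.hasDerivAt (p 1)).comp_hasFDerivAt p (hasFDerivAt_apply (𝕜 := ℝ) 1 p))

theorem contDiff_mul (hφ : IsBoundedC1 φ φ') (hH : IsBoundedC1 H H') :
    ContDiff ℝ 1 (fun p : Fin 2 → ℝ => φ (p 0) * H (p 1)) :=
  (hφ.contDiff.comp (contDiff_apply ℝ ℝ 0)).mul (hH.contDiff.comp (contDiff_apply ℝ ℝ 1))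

theorem lipschitz_mul (hφ : IsBoundedC1 φ φ') (hH : IsBoundedC1 H H') :
    ∃ K, LipschitzWith K (fun p : Fin 2 → ℝ => φ (p 0) * H (p 1)) := by
  obtain ⟨B, hB⟩ := hφ.bounded
  obtain ⟨C, hC⟩ := hφ.bounded_deriv
  obtain ⟨B', hB'⟩ := hH.bounded
  obtain ⟨C', hC'⟩ := hH.bounded_deriv
  have hB0 : 0 ≤ B := (abs_nonneg _).trans (hB 0)
  have hC0 : 0 ≤ C := (abs_nonneg _).trans (hC 0)
  have hB0' : 0 ≤ B' := (abs_nonneg _).trans (hB' 0)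
  have hC0' : 0 ≤ C' := (abs_nonneg _).trans (hC' 0)
  refine ⟨(B * C' + B' * C).toNNReal, lipschitzWith_of_nnnorm_fderiv_le (𝕜 := ℝ)
    (fun p => (hφ.hasFDerivAt_mul hH p).differentiableAt) fun p => ?_⟩
  rw [← NNReal.coe_le_coe, coe_nnnorm, (hφ.hasFDerivAt_mul hH p).fderiv,
    Real.coe_toNNReal _ (by positivity)]
  refine ContinuousLinearMap.opNorm_le_bound _ (by positivity) fun q => ?_
  have h0 : |q 0| ≤ ‖q‖ := norm_le_pi_norm q 0
  have h1 : |q 1| ≤ ‖q‖ := norm_le_pi_norm q 1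
  calc ‖φ (p 0) * (H' (p 1) * q 1) + H (p 1) * (φ' (p 0) * q 0)‖
      ≤ |φ (p 0)| * (|H' (p 1)| * |q 1|) + |H (p 1)| * (|φ' (p 0)| * |q 0|) := by
        refine (norm_add_le _ _).trans_eq ?_
        simp only [Real.norm_eq_abs, abs_mul]
    _ ≤ B * (C' * ‖q‖) + B' * (C * ‖q‖) := by
        gcongr
        exacts [hB _, hC' _, hB' _, hC _]
    _ = (B * C' + B' * C) * ‖q‖ := by ring

end IsBoundedC1

namespace ErrorStructure

variable {Ω : Type*} [MeasurableSpace Ω] {P : Measure Ω} [IsProbabilityMeasure P]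
variable {φ φ' H H' : ℝ → ℝ}

theorem mem_mul_comp (S : ErrorStructure P) (X U : S.D) (hφ : IsBoundedC1 φ φ')
    (hH : IsBoundedC1 H H') {f : Ω → ℝ}
    (hf : ∀ᵐ ω ∂P, f ω = φ ((X : Lp ℝ 2 P) ω) * H ((U : Lp ℝ 2 P) ω)) : S.Mem f := by
  obtain ⟨B, hB⟩ := hφ.bounded
  obtain ⟨B', hB'⟩ := hH.bounded
  refine S.mem_of_bounded ![X, U] (F := fun p => φ (p 0) * H (p 1)) (hφ.contDiff_mul hH)
    (hφ.lipschitz_mul hH) (B := B * B') (fun p => ?_) hf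
  rw [abs_mul]
  exact mul_le_mul (hB _) (hB' _) (abs_nonneg _) ((abs_nonneg _).trans (hB 0))

theorem gamma_mul_comp (S : ErrorStructure P) (X U : S.D) (hφ : IsBoundedC1 φ φ')
    (hH : IsBoundedC1 H H') {w : S.D}
    (hw : ∀ᵐ ω ∂P, (w : Lp ℝ 2 P) ω = φ ((X : Lp ℝ 2 P) ω) * H ((U : Lp ℝ 2 P) ω)) :
    ∀ᵐ ω ∂P, S.Gamma X w ω =
      φ' ((X : Lp ℝ 2 P) ω) * H ((U : Lp ℝ 2 P) ω) * S.Gamma X X ω +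
      φ ((X : Lp ℝ 2 P) ω) * H' ((U : Lp ℝ 2 P) ω) * S.Gamma X U ω := by
  filter_upwards [S.gamma_comp_right X ![X, U] (G := fun p => φ (p 0) * H (p 1))
    (hφ.contDiff_mul hH) (hφ.lipschitz_mul hH) hw] with ω h
  rw [h, (hφ.hasFDerivAt_mul hH _).fderiv, Fin.sum_univ_two]
  simp [-mul_eq_mul_right_iff]
  ring

theorem mem_comp (S : ErrorStructure P) (U : S.D) (hH : IsBoundedC1 H H') {f : Ω → ℝ}
    (hf : ∀ᵐ ω ∂P, f ω = H ((U : Lp ℝ 2 P) ω)) : S.Mem f :=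
  S.mem_mul_comp U U (IsBoundedC1.const 1) hH (by simpa using hf)

theorem gammaWith_comp (S : ErrorStructure P) (X U : S.D) (hH : IsBoundedC1 H H') {f : Ω → ℝ}
    (hf : ∀ᵐ ω ∂P, f ω = H ((U : Lp ℝ 2 P) ω)) :
    ∀ᵐ ω ∂P, S.gammaWith X f ω = H' ((U : Lp ℝ 2 P) ω) * S.Gamma X U ω := by
  obtain ⟨q, hq⟩ := S.mem_comp U hH hf
  rw [S.gammaWith_eq X f q hq]
  have hq' : ∀ᵐ ω ∂P, (q : Lp ℝ 2 P) ω =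
      (fun _ => (1 : ℝ)) ((X : Lp ℝ 2 P) ω) * H ((U : Lp ℝ 2 P) ω) := by
    filter_upwards [hq, hf] with ω h1 h2
    rw [h1, h2, one_mul]
  filter_upwards [S.gamma_mul_comp X U (IsBoundedC1.const 1) hH hq'] with ω h
  simpa using h

/-- The factor `Γ[X, 1/R] + 2 A[X] / R` of the density integrand. -/
noncomputable def weight (S : ErrorStructure P) (X : S.D) (hX : X ∈ S.generatorDomain)
    (R : Ω → ℝ) (ω : Ω) : ℝ :=
  S.gammaWith X (fun ω' => 1 / R ω') ω + 2 * S.generator X hX ω / R ω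

theorem integrable_weight (S : ErrorStructure P) (X : S.D) (hX : X ∈ S.generatorDomain)
    {R : Ω → ℝ} (hR : S.Mem fun ω => 1 / R ω) : Integrable (S.weight X hX R) P := by
  obtain ⟨q, hq⟩ := hR
  have h2 : Integrable (fun ω => 2 * (S.generator X hX ω * (q : Lp ℝ 2 P) ω)) P :=
    ((Lp.memLp (S.generator X hX)).integrable_mul (Lp.memLp (q : Lp ℝ 2 P))).const_mul 2
  refine ((S.integrable_gammaWith X fun ω => 1 / R ω).add h2).congr ?_
  filter_upwards [hq] with ω h
  simp only [Pi.add_apply, weight, h]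
  ring

theorem integrable_densityIntegrand (S : ErrorStructure P) (X : S.D)
    (hX : X ∈ S.generatorDomain) {R : Ω → ℝ} (hR : S.Mem fun ω => 1 / R ω) (x : ℝ) :
    Integrable (S.densityIntegrand X hX R x) P :=
  integrable_sign_mul (S.measurable_coe X) (S.integrable_weight X hX hR) x

/-- Integration by parts: test the definition of `A[X]` against `φ(X) / R ∈ 𝔻` and expand
`Γ[X, φ(X) / R]` by the functional calculus. -/
theorem integral_deriv_mul_gamma (S : ErrorStructure P) (X U : S.D)
    (hX : X ∈ S.generatorDomain) (hφ : IsBoundedC1 φ φ') (hH : IsBoundedC1 H H') {R : Ω → ℝ}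
    (hR : ∀ᵐ ω ∂P, 1 / R ω = H ((U : Lp ℝ 2 P) ω)) :
    ∫ ω, φ' ((X : Lp ℝ 2 P) ω) * (S.Gamma X X ω / R ω) ∂P =
      -∫ ω, φ ((X : Lp ℝ 2 P) ω) * S.weight X hX R ω ∂P := by
  obtain ⟨w, hw⟩ := S.mem_mul_comp X U hφ hH (ae_of_all _ fun _ => rfl)
  have hZ := S.integrable_weight X hX (S.mem_comp U hH hR)
  obtain ⟨B, hB⟩ := hφ.bounded
  have hφZ : Integrable (fun ω => φ ((X : Lp ℝ 2 P) ω) * S.weight X hX R ω) P :=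
    hZ.bdd_mul (c := B)
      (hφ.contDiff.continuous.measurable.comp (S.measurable_coe X)).aestronglyMeasurable
      (ae_of_all _ fun _ => hB _)
  have hAw : Integrable (fun ω => S.generator X hX ω * (w : Lp ℝ 2 P) ω) P :=
    (Lp.memLp (S.generator X hX)).integrable_mul (Lp.memLp (w : Lp ℝ 2 P))
  have hibp : ∫ ω, S.Gamma X w ω ∂P
      = -(2 * ∫ ω, S.generator X hX ω * (w : Lp ℝ 2 P) ω ∂P) := by
    have h := S.energy_eq_neg_inner_generator X hX w
    rw [energy, L2.inner_def] at h
    simp only [RCLike.inner_apply, conj_trivial] at h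
    simp_rw [mul_comm (S.generator X hX _)]
    linarith
  have hsum : ∀ᵐ ω ∂P, φ' ((X : Lp ℝ 2 P) ω) * (S.Gamma X X ω / R ω)
      = S.Gamma X w ω + 2 * (S.generator X hX ω * (w : Lp ℝ 2 P) ω)
        - φ ((X : Lp ℝ 2 P) ω) * S.weight X hX R ω := by
    filter_upwards [hw, hR, S.gamma_mul_comp X U hφ hH hw, S.gammaWith_comp X U hH hR]
      with ω h1 h2 h3 h4
    have hdiv : ∀ c, c / R ω = c * H ((U : Lp ℝ 2 P) ω) := fun c => by rw [← h2, mul_one_div]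
    rw [weight, h3, h4, h1, hdiv, hdiv]
    ring
  rw [integral_congr_ae hsum, integral_sub
    (f := fun ω => S.Gamma X w ω + 2 * (S.generator X hX ω * (w : Lp ℝ 2 P) ω)) ((S.integrable_gamma X w).add (hAw.const_mul 2)) hφZ,
    integral_add (S.integrable_gamma X w) (hAw.const_mul 2), integral_const_mul, hibp]
  ring

theorem isWeightedDensity_weight (S : ErrorStructure P) (X U : S.D)
    (hX : X ∈ S.generatorDomain) (hH : IsBoundedC1 H H') {R : Ω → ℝ}
    (hR : ∀ᵐ ω ∂P, 1 / R ω = H ((U : Lp ℝ 2 P) ω)) :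
    IsWeightedDensity P (X : Lp ℝ 2 P) (S.weight X hX R) (fun ω => S.Gamma X X ω / R ω) := by
  intro ψ hψ hc
  have hi := hψ.integrable_of_hasCompactSupport (μ := volume) hc
  have hφ : IsBoundedC1 (signPrimitive ψ) ψ :=
    { hasDerivAt := hasDerivAt_signPrimitive hψ hi
      continuous_deriv := hψ
      bounded := ⟨_, abs_signPrimitive_le hi⟩
      bounded_deriv := hψ.bounded_above_of_compact_support hc }
  rw [integral_mul_signDensity hi (S.measurable_coe X)
    (S.integrable_weight X hX (S.mem_comp U hH hR)), S.integral_deriv_mul_gamma X U hX hφ hH hR]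

end ErrorStructure

/-! ### Regularised densities and their limit -/

theorem isBoundedC1_saturation {ε : ℝ} (hε : 0 < ε) :
    IsBoundedC1 (saturation ε) (fun y => ε / (ε + |y|) ^ 2) where
  hasDerivAt := hasDerivAt_saturation hε
  continuous_deriv := continuous_deriv_saturation hε
  bounded := ⟨1, abs_saturation_le_one hε⟩
  bounded_deriv := ⟨1 / ε, abs_deriv_saturation_le hε⟩

theorem IsBoundedC1.affine {φ φ' : ℝ → ℝ} (h : IsBoundedC1 φ φ') (a b : ℝ) :
    IsBoundedC1 (fun y => a + b * φ y) (fun y => b * φ' y) where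
  hasDerivAt y := ((h.hasDerivAt y).const_mul b).const_add a
  continuous_deriv := h.continuous_deriv.const_mul b
  bounded := by
    obtain ⟨B, hB⟩ := h.bounded
    refine ⟨|a| + |b| * B, fun y => (abs_add_le _ _).trans ?_⟩
    rw [abs_mul]
    gcongr
    exact hB y
  bounded_deriv := by
    obtain ⟨C, hC⟩ := h.bounded_deriv
    refine ⟨|b| * C, fun y => ?_⟩
    rw [abs_mul]
    gcongr
    exact hC y

/-- The law of `X` is the increasing limit of the laws weighted by `k n ↑ 1`, hence its density is
the limit of theirs. -/
theorem map_eq_withDensity_of_tendsto {Ω : Type*} [MeasurableSpace Ω] {P : Measure Ω}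
    {X : Ω → ℝ} (hX : Measurable X) {k : ℕ → Ω → ℝ≥0∞} {g : ℕ → ℝ → ℝ≥0∞} {f : ℝ → ℝ≥0∞}
    (hk : ∀ n, AEMeasurable (k n) P) (hg : ∀ n, Measurable (g n))
    (hkg : ∀ n, (P.withDensity (k n)).map X = (volume : Measure ℝ).withDensity (g n))
    (hk_mono : ∀ᵐ ω ∂P, Monotone fun n => k n ω)
    (hk_lim : ∀ᵐ ω ∂P, Tendsto (fun n => k n ω) atTop (𝓝 1))
    (hg_mono : ∀ x, Monotone fun n => g n x)
    (hg_lim : ∀ x, Tendsto (fun n => g n x) atTop (𝓝 (f x))) :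
    P.map X = (volume : Measure ℝ).withDensity f := by
  ext A hA
  have h1 : Tendsto (fun n => ∫⁻ ω in X ⁻¹' A, k n ω ∂P) atTop (𝓝 (∫⁻ _ in X ⁻¹' A, 1 ∂P)) :=
    lintegral_tendsto_of_tendsto_of_monotone (fun n => (hk n).restrict)
      (ae_restrict_of_ae hk_mono) (ae_restrict_of_ae hk_lim)
  have h2 : Tendsto (fun n => ∫⁻ x in A, g n x) atTop (𝓝 (∫⁻ x in A, f x)) :=
    lintegral_tendsto_of_tendsto_of_monotone (fun n => (hg n).aemeasurable)
      (ae_of_all _ hg_mono) (ae_of_all _ hg_lim)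
  have h3 : ∀ n, ∫⁻ ω in X ⁻¹' A, k n ω ∂P = ∫⁻ x in A, g n x := fun n => by
    rw [← withDensity_apply _ (hX hA), ← Measure.map_apply hX hA, hkg n, withDensity_apply _ hA]
  rw [Measure.map_apply hX hA, withDensity_apply _ hA, ← setLIntegral_one]
  exact tendsto_nhds_unique h1 (by simpa only [h3] using h2)

namespace ErrorStructure

variable {Ω : Type*} [MeasurableSpace Ω] {P : Measure Ω} [IsProbabilityMeasure P]

theorem inv_add_gamma_eq (S : ErrorStructure P) (X U : S.D)
    (hU : ∀ᵐ ω ∂P, (U : Lp ℝ 2 P) ω = S.Gamma X X ω) {ε : ℝ} (hε : 0 < ε) :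
    ∀ᵐ ω ∂P, 1 / (ε + S.Gamma X X ω)
      = 1 / ε + -(1 / ε) * saturation ε ((U : Lp ℝ 2 P) ω) := by
  filter_upwards [hU, S.gamma_nonneg X] with ω h1 h2
  rw [h1, saturation, abs_of_nonneg h2]
  have : ε + S.Gamma X X ω ≠ 0 := by positivity
  field_simp
  ring

theorem mem_inv_add_gamma (S : ErrorStructure P) (X : S.D)
    (hΓ : S.Mem fun ω => S.Gamma X X ω) {ε : ℝ} (hε : 0 < ε) :
    S.Mem fun ω => 1 / (ε + S.Gamma X X ω) := by
  obtain ⟨U, hU⟩ := hΓ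
  exact S.mem_comp U ((isBoundedC1_saturation hε).affine _ _) (S.inv_add_gamma_eq X U hU hε)

/-- The density `x ↦ ½ E[sign(x - X) (Γ[X, 1/(ε + Γ[X])] + 2 A[X] / (ε + Γ[X]))]` of the law of `X`
weighted by `Γ[X] / (ε + Γ[X])`. -/
noncomputable def regDensity (S : ErrorStructure P) (X : S.D) (hX : X ∈ S.generatorDomain)
    (ε x : ℝ) : ℝ :=
  signDensity P (X : Lp ℝ 2 P) (S.weight X hX fun ω => ε + S.Gamma X X ω) x

theorem isWeightedDensity_reg (S : ErrorStructure P) (X : S.D) (hX : X ∈ S.generatorDomain)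
    (hΓ : S.Mem fun ω => S.Gamma X X ω) {ε : ℝ} (hε : 0 < ε) :
    IsWeightedDensity P (X : Lp ℝ 2 P) (S.weight X hX fun ω => ε + S.Gamma X X ω)
      (fun ω => S.Gamma X X ω / (ε + S.Gamma X X ω)) := by
  obtain ⟨U, hU⟩ := hΓ
  exact S.isWeightedDensity_weight X U hX ((isBoundedC1_saturation hε).affine _ _)
    (S.inv_add_gamma_eq X U hU hε)

theorem integrable_gamma_div (S : ErrorStructure P) (X : S.D) {ε : ℝ} (hε : 0 < ε) :
    Integrable (fun ω => S.Gamma X X ω / (ε + S.Gamma X X ω)) P := by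
  have hm : Measurable (S.Gamma X X) := (Lp.stronglyMeasurable _).measurable
  refine Integrable.of_bound (hm.div (hm.const_add ε)).aestronglyMeasurable 1 ?_
  filter_upwards [S.gamma_nonneg X] with ω h
  rw [Real.norm_eq_abs, abs_of_nonneg (by positivity), div_le_one (by positivity)]
  linarith

theorem ae_ne_of_gamma_pos (S : ErrorStructure P) (X : S.D) (hX : X ∈ S.generatorDomain)
    (hΓ : S.Mem fun ω => S.Gamma X X ω) (hpos : ∀ᵐ ω ∂P, 0 < S.Gamma X X ω) (x : ℝ) :
    ∀ᵐ ω ∂P, (X : Lp ℝ 2 P) ω ≠ x := by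
  refine (S.isWeightedDensity_reg X hX hΓ one_pos).ae_ne (S.measurable_coe X)
    (S.integrable_weight X hX (S.mem_inv_add_gamma X hΓ one_pos))
    (S.integrable_gamma_div X one_pos) ?_ x
  filter_upwards [hpos] with ω h
  positivity

theorem continuous_regDensity (S : ErrorStructure P) (X : S.D) (hX : X ∈ S.generatorDomain)
    (hΓ : S.Mem fun ω => S.Gamma X X ω) (hpos : ∀ᵐ ω ∂P, 0 < S.Gamma X X ω) {ε : ℝ}
    (hε : 0 < ε) : Continuous (S.regDensity X hX ε) :=
  continuous_signDensity (S.measurable_coe X)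
    (S.integrable_weight X hX (S.mem_inv_add_gamma X hΓ hε)) (S.ae_ne_of_gamma_pos X hX hΓ hpos)

theorem regDensity_nonneg (S : ErrorStructure P) (X : S.D) (hX : X ∈ S.generatorDomain)
    (hΓ : S.Mem fun ω => S.Gamma X X ω) (hpos : ∀ᵐ ω ∂P, 0 < S.Gamma X X ω) {ε : ℝ}
    (hε : 0 < ε) (x : ℝ) : 0 ≤ S.regDensity X hX ε x := by
  refine (S.isWeightedDensity_reg X hX hΓ hε).nonneg (S.measurable_coe X)
    (S.integrable_weight X hX (S.mem_inv_add_gamma X hΓ hε)) ?_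
    (S.ae_ne_of_gamma_pos X hX hΓ hpos) x
  filter_upwards [hpos] with ω h
  positivity

theorem gamma_div_antitone {γ ε ε' : ℝ} (hγ : 0 ≤ γ) (hε : 0 < ε) (h : ε ≤ ε') :
    γ / (ε' + γ) ≤ γ / (ε + γ) := by
  gcongr

theorem antitoneOn_regDensity (S : ErrorStructure P) (X : S.D) (hX : X ∈ S.generatorDomain)
    (hΓ : S.Mem fun ω => S.Gamma X X ω) (hpos : ∀ᵐ ω ∂P, 0 < S.Gamma X X ω) (x : ℝ) :
    AntitoneOn (fun ε => S.regDensity X hX ε x) (Ioi 0) := by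
  intro ε (hε : 0 < ε) ε' (hε' : 0 < ε') hle
  refine (S.isWeightedDensity_reg X hX hΓ hε').le_of_ae_le (S.isWeightedDensity_reg X hX hΓ hε)
    (S.measurable_coe X) (S.integrable_weight X hX (S.mem_inv_add_gamma X hΓ hε'))
    (S.integrable_weight X hX (S.mem_inv_add_gamma X hΓ hε)) (S.integrable_gamma_div X hε')
    (S.integrable_gamma_div X hε) (S.ae_ne_of_gamma_pos X hX hΓ hpos) ?_ x
  filter_upwards [hpos] with ω h using gamma_div_antitone h.le hε hle

/-- The increasing limit of the regularised densities. -/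
noncomputable def lscDensity (S : ErrorStructure P) (X : S.D) (hX : X ∈ S.generatorDomain)
    (x : ℝ) : ℝ≥0∞ :=
  ⨆ ε ∈ Ioi (0 : ℝ), ENNReal.ofReal (S.regDensity X hX ε x)

theorem lowerSemicontinuous_lscDensity (S : ErrorStructure P) (X : S.D)
    (hX : X ∈ S.generatorDomain) (hΓ : S.Mem fun ω => S.Gamma X X ω)
    (hpos : ∀ᵐ ω ∂P, 0 < S.Gamma X X ω) : LowerSemicontinuous (S.lscDensity X hX) :=
  lowerSemicontinuous_biSup fun _ hε =>
    (ENNReal.continuous_ofReal.comp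
      (S.continuous_regDensity X hX hΓ hpos hε)).lowerSemicontinuous

theorem tendsto_ofReal_regDensity (S : ErrorStructure P) (X : S.D)
    (hX : X ∈ S.generatorDomain) (hΓ : S.Mem fun ω => S.Gamma X X ω)
    (hpos : ∀ᵐ ω ∂P, 0 < S.Gamma X X ω) (x : ℝ) :
    Tendsto (fun ε => ENNReal.ofReal (S.regDensity X hX ε x)) (𝓝[>] 0)
      (𝓝 (S.lscDensity X hX x)) := by
  have h : AntitoneOn (fun ε => ENNReal.ofReal (S.regDensity X hX ε x)) (Ioi 0) :=
    fun ε hε ε' hε' hle =>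
      ENNReal.ofReal_le_ofReal (S.antitoneOn_regDensity X hX hΓ hpos x hε hε' hle)
  have ht := h.tendsto_nhdsGT (OrderTop.bddAbove _)
  rwa [sSup_image] at ht

theorem tendsto_coe_regDensity (S : ErrorStructure P) (X : S.D)
    (hX : X ∈ S.generatorDomain) (hΓ : S.Mem fun ω => S.Gamma X X ω)
    (hpos : ∀ᵐ ω ∂P, 0 < S.Gamma X X ω) (x : ℝ) :
    Tendsto (fun ε => (S.regDensity X hX ε x : EReal)) (𝓝[>] 0)
      (𝓝 (S.lscDensity X hX x : EReal)) := by
  refine ((continuous_coe_ennreal_ereal.tendsto _).comp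
    (S.tendsto_ofReal_regDensity X hX hΓ hpos x)).congr' ?_
  filter_upwards [self_mem_nhdsWithin] with ε hε
  rw [Function.comp_apply, EReal.coe_ennreal_ofReal,
    max_eq_left (S.regDensity_nonneg X hX hΓ hpos hε x)]

theorem map_eq_withDensity_lscDensity (S : ErrorStructure P) (X : S.D)
    (hX : X ∈ S.generatorDomain) (hΓ : S.Mem fun ω => S.Gamma X X ω)
    (hpos : ∀ᵐ ω ∂P, 0 < S.Gamma X X ω) :
    P.map (X : Lp ℝ 2 P) = (volume : Measure ℝ).withDensity (S.lscDensity X hX) := by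
  have hn : ∀ n : ℕ, (0 : ℝ) < 1 / (n + 1) := fun n => Nat.one_div_pos_of_nat
  have hanti : ∀ m n : ℕ, m ≤ n → (1 : ℝ) / (n + 1) ≤ 1 / (m + 1) :=
    fun m n h => Nat.one_div_le_one_div h
  have hlim : Tendsto (fun n : ℕ => (1 : ℝ) / (n + 1)) atTop (𝓝 0) :=
    tendsto_one_div_add_atTop_nhds_zero_nat
  have hlim' : Tendsto (fun n : ℕ => (1 : ℝ) / (n + 1)) atTop (𝓝[>] 0) :=
    tendsto_nhdsWithin_iff.mpr ⟨hlim, Eventually.of_forall hn⟩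
  refine map_eq_withDensity_of_tendsto (S.measurable_coe X)
    (k := fun n ω => ENNReal.ofReal (S.Gamma X X ω / (1 / ((n : ℝ) + 1) + S.Gamma X X ω)))
    (g := fun n x => ENNReal.ofReal (S.regDensity X hX (1 / ((n : ℝ) + 1)) x))
    (fun n => (S.integrable_gamma_div X (hn n)).1.aemeasurable.ennreal_ofReal)
    (fun n => (S.continuous_regDensity X hX hΓ hpos (hn n)).measurable.ennreal_ofReal)
    (fun n => ?_) ?_ ?_ (fun x m n h => ?_)
    (fun x => (S.tendsto_ofReal_regDensity X hX hΓ hpos x).comp hlim')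
  · refine (S.isWeightedDensity_reg X hX hΓ (hn n)).map_withDensity (S.measurable_coe X)
      (S.integrable_weight X hX (S.mem_inv_add_gamma X hΓ (hn n)))
      (S.integrable_gamma_div X (hn n)) ?_ (S.ae_ne_of_gamma_pos X hX hΓ hpos)
    filter_upwards [hpos] with ω h
    have := hn n
    positivity
  · filter_upwards [hpos] with ω h m n hmn
    exact ENNReal.ofReal_le_ofReal (gamma_div_antitone h.le (hn n) (hanti m n hmn))
  · filter_upwards [hpos] with ω h
    have h1 : Tendsto (fun n : ℕ => S.Gamma X X ω / (1 / ((n : ℝ) + 1) + S.Gamma X X ω)) atTop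
        (𝓝 1) := by
      have := (tendsto_const_nhds (x := S.Gamma X X ω)).div (hlim.add_const (S.Gamma X X ω))
        (by rw [zero_add]; exact h.ne')
      rwa [zero_add, div_self h.ne'] at this
    simpa using ENNReal.tendsto_ofReal h1
  · exact ENNReal.ofReal_le_ofReal
      (S.antitoneOn_regDensity X hX hΓ hpos x (hn n) (hn m) (hanti m n h))

/-- When `h = 1 / Γ[X]` is in `𝔻`, one has `1 / (ε + Γ[X]) = h / (1 + ε h)`, so the functional
calculus gives `Γ[X, 1 / (ε + Γ[X])] = Γ[X, h] / (1 + ε h)²`, which is dominated by `|Γ[X, h]|`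
and converges to `Γ[X, h]`. -/
theorem tendsto_regDensity (S : ErrorStructure P) (X : S.D) (hX : X ∈ S.generatorDomain)
    (hpos : ∀ᵐ ω ∂P, 0 < S.Gamma X X ω) (hinv : S.Mem fun ω => 1 / S.Gamma X X ω) (x : ℝ) :
    Tendsto (fun ε => S.regDensity X hX ε x) (𝓝[>] 0)
      (𝓝 (signDensity P (X : Lp ℝ 2 P) (S.weight X hX fun ω => S.Gamma X X ω) x)) := by
  obtain ⟨h, hh⟩ := id hinv
  have hA : Integrable (fun ω => S.generator X hX ω * (h : Lp ℝ 2 P) ω) P :=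
    (Lp.memLp (S.generator X hX)).integrable_mul (Lp.memLp (h : Lp ℝ 2 P))
  -- The factor by which the functional calculus changes `Γ[X, h]`.
  have hweight : ∀ ε : ℝ, 0 < ε → ∀ᵐ ω ∂P, S.weight X hX (fun ω => ε + S.Gamma X X ω) ω
      = S.Gamma X h ω / (1 + ε * (h : Lp ℝ 2 P) ω) ^ 2 +
        2 * S.generator X hX ω / (ε + S.Gamma X X ω) := by
    intro ε hε
    have hε' : 0 < 1 / ε := by positivity
    have hcalc : ∀ᵐ ω ∂P, 1 / (ε + S.Gamma X X ω)
        = 0 + 1 / ε * saturation (1 / ε) ((h : Lp ℝ 2 P) ω) := by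
      filter_upwards [hh, hpos] with ω h1 h2
      rw [h1, saturation, abs_of_pos (by positivity)]
      field_simp
      ring
    filter_upwards [hh, hpos, S.gammaWith_comp X h ((isBoundedC1_saturation hε').affine 0 (1 / ε))
      hcalc] with ω h1 h2 h3
    have h4 : 0 < (h : Lp ℝ 2 P) ω := by rw [h1]; positivity
    rw [weight, h3, abs_of_pos h4]
    congr 1
    field_simp
  -- Each identity of `hweight` has its own null set, so it is used under the integral sign, and
  -- the pointwise limit is taken in the explicit expression.
  have hreg : ∀ ε : ℝ, 0 < ε → S.regDensity X hX ε x = (1 / 2) *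
      ∫ ω, Real.sign (x - (X : Lp ℝ 2 P) ω) * (S.Gamma X h ω / (1 + ε * (h : Lp ℝ 2 P) ω) ^ 2 +
        2 * S.generator X hX ω / (ε + S.Gamma X X ω)) ∂P := by
    intro ε hε
    rw [regDensity, signDensity]
    congr 1
    refine integral_congr_ae ?_
    filter_upwards [hweight ε hε] with ω h1
    rw [h1]
  refine Tendsto.congr' (f₁ := fun ε => (1 / 2) *
      ∫ ω, Real.sign (x - (X : Lp ℝ 2 P) ω) * (S.Gamma X h ω / (1 + ε * (h : Lp ℝ 2 P) ω) ^ 2 +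
        2 * S.generator X hX ω / (ε + S.Gamma X X ω)) ∂P)
    (by filter_upwards [self_mem_nhdsWithin] with ε hε using (hreg ε hε).symm) ?_
  refine Tendsto.const_mul _ (tendsto_integral_filter_of_dominated_convergence
    (fun ω => |S.Gamma X h ω| + 2 * |S.generator X hX ω * (h : Lp ℝ 2 P) ω|) ?_ ?_
    ((S.integrable_gamma X h).abs.add (hA.abs.const_mul 2)) ?_)
  · refine Eventually.of_forall fun ε => ?_
    have m1 : Measurable (S.Gamma X h) := (Lp.stronglyMeasurable _).measurable
    have m2 : Measurable (S.Gamma X X) := (Lp.stronglyMeasurable _).measurable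
    have m3 : Measurable (S.generator X hX) := (Lp.stronglyMeasurable _).measurable
    have m4 := S.measurable_coe h
    have hs : Measurable fun ω => Real.sign (x - (X : Lp ℝ 2 P) ω) :=
      Real.measurable_sign.comp (measurable_const.sub (S.measurable_coe X))
    exact Measurable.aestronglyMeasurable (by fun_prop)
  · filter_upwards [self_mem_nhdsWithin] with ε (hε : 0 < ε)
    filter_upwards [hh, hpos] with ω h2 h3
    have h4 : 0 < (h : Lp ℝ 2 P) ω := by rw [h2]; positivity
    rw [Real.norm_eq_abs, abs_mul]
    refine (mul_le_of_le_one_left (abs_nonneg _) (Real.abs_sign_le_one _)).trans ?_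
    refine (abs_add_le _ _).trans (add_le_add ?_ ?_)
    · rw [abs_div]
      refine div_le_self (abs_nonneg _) ?_
      rw [abs_of_pos (by positivity)]
      nlinarith [mul_pos hε h4]
    · rw [h2, abs_div, abs_mul, abs_mul, abs_of_pos (by positivity : 0 < ε + S.Gamma X X ω),
        abs_of_pos (by positivity : 0 < 1 / S.Gamma X X ω), abs_two, mul_one_div, ← mul_div_assoc]
      gcongr
      linarith
  · filter_upwards [hpos] with ω h3
    have hcont : ContinuousAt (fun ε : ℝ => Real.sign (x - (X : Lp ℝ 2 P) ω) *
        (S.Gamma X h ω / (1 + ε * (h : Lp ℝ 2 P) ω) ^ 2 +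
          2 * S.generator X hX ω / (ε + S.Gamma X X ω))) 0 := by
      have e1 : (1 + 0 * (h : Lp ℝ 2 P) ω) ^ 2 ≠ 0 := by simp
      have e2 : 0 + S.Gamma X X ω ≠ 0 := by simpa using h3.ne'
      fun_prop (disch := assumption)
    have ht := hcont.tendsto.mono_left (nhdsWithin_le_nhds (s := Ioi 0))
    rw [weight, S.gammaWith_eq X _ h hh]
    simpa using ht

theorem ofReal_signDensity_eq_lscDensity (S : ErrorStructure P) (X : S.D)
    (hX : X ∈ S.generatorDomain) (hΓ : S.Mem fun ω => S.Gamma X X ω)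
    (hpos : ∀ᵐ ω ∂P, 0 < S.Gamma X X ω) (hinv : S.Mem fun ω => 1 / S.Gamma X X ω) (x : ℝ) :
    ENNReal.ofReal (signDensity P (X : Lp ℝ 2 P) (S.weight X hX fun ω => S.Gamma X X ω) x) =
      S.lscDensity X hX x :=
  tendsto_nhds_unique (ENNReal.tendsto_ofReal (S.tendsto_regDensity X hX hpos hinv x))
    (S.tendsto_ofReal_regDensity X hX hΓ hpos x)

end ErrorStructure

theorem proposition4 {Ω : Type*} [MeasurableSpace Ω] (P : Measure Ω) [IsProbabilityMeasure P]
    (S : ErrorStructure P) (X : S.D) (hX : X ∈ S.generatorDomain)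
    (hΓ : S.Mem (fun ω => S.Gamma X X ω)) (hpos : ∀ᵐ ω ∂P, 0 < S.Gamma X X ω) :
    ((∀ ε : ℝ, 0 < ε → S.Mem (fun ω => 1 / (ε + S.Gamma X X ω)) ∧
        ∀ x : ℝ, Integrable (S.densityIntegrand X hX (fun ω => ε + S.Gamma X X ω) x) P) ∧
      ∃ f : ℝ → ℝ≥0∞, LowerSemicontinuous f ∧
        P.map (fun ω => (X : Lp ℝ 2 P) ω) = (volume : Measure ℝ).withDensity f ∧
        ∀ x : ℝ,
          AntitoneOn (fun ε : ℝ =>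
            (1 / 2) * ∫ ω, S.densityIntegrand X hX (fun ω => ε + S.Gamma X X ω) x ω ∂P)
            (Ioi 0) ∧
          Tendsto (fun ε : ℝ =>
            (((1 / 2) * ∫ ω, S.densityIntegrand X hX (fun ω => ε + S.Gamma X X ω) x ω ∂P : ℝ) :
              EReal))
            (𝓝[>] 0) (𝓝 ((f x : ℝ≥0∞) : EReal))) ∧
    (S.Mem (fun ω => 1 / S.Gamma X X ω) →
      (∀ x : ℝ, Integrable (S.densityIntegrand X hX (fun ω => S.Gamma X X ω) x) P) ∧
      ∃ f : ℝ → ℝ, AbsolutelyContinuousOnReal f ∧ (∀ x, 0 ≤ f x) ∧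
        P.map (fun ω => (X : Lp ℝ 2 P) ω) =
          (volume : Measure ℝ).withDensity (fun x => ENNReal.ofReal (f x)) ∧
        ∀ x : ℝ, f x =
          (1 / 2) * ∫ ω, S.densityIntegrand X hX (fun ω => S.Gamma X X ω) x ω ∂P) := by
  refine ⟨⟨fun ε hε => ⟨S.mem_inv_add_gamma X hΓ hε,
    S.integrable_densityIntegrand X hX (S.mem_inv_add_gamma X hΓ hε)⟩,
    S.lscDensity X hX, S.lowerSemicontinuous_lscDensity X hX hΓ hpos,
    S.map_eq_withDensity_lscDensity X hX hΓ hpos,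
    fun x => ⟨S.antitoneOn_regDensity X hX hΓ hpos x,
      S.tendsto_coe_regDensity X hX hΓ hpos x⟩⟩, fun hinv =>
    ⟨S.integrable_densityIntegrand X hX hinv,
      signDensity P (X : Lp ℝ 2 P) (S.weight X hX fun ω => S.Gamma X X ω), ?_, fun x => ?_, ?_,
      fun _ => rfl⟩⟩
  · exact absolutelyContinuousOnReal_signDensity (S.measurable_coe X)
      (S.integrable_weight X hX hinv) (S.ae_ne_of_gamma_pos X hX hΓ hpos)
      (S.map_eq_withDensity_lscDensity X hX hΓ hpos)
  · refine ge_of_tendsto (S.tendsto_regDensity X hX hpos hinv x) ?_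
    filter_upwards [self_mem_nhdsWithin] with ε hε using
      S.regDensity_nonneg X hX hΓ hpos hε x
  · simp_rw [S.ofReal_signDensity_eq_lscDensity X hX hΓ hpos hinv]
    exact S.map_eq_withDensity_lscDensity X hX hΓ hpos
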